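/- Let $\Omega\subset\mathbb{R}^n$ be open, let $\lambda^1,\dots,\lambda^n\in C^\infty(\Omega)$ satisfy $\lambda^k\neq\lambda^m$ everywhere on $\Omega$ for $k\neq m$, and consider the diagonal system $u^k_t=\lambda^k(u)u^k_x$, $k=1,\dots,n$ (no summation), $u\in\Omega$. Write $\partial_k=\partial/\partial u^k$ and $a_{km}=\dfrac{\partial_m\lambda^k}{\lambda^m-\lambda^k}$ for $k\ne m$, and suppose the system is semihamiltonian: $\partial_m a_{kl}=\partial_l a_{km}$ for pairwise distinct $k,l,m$. The $i$-th Monge characteristic distribution is the distribution on the space of $(x,t,u,u_x)\in\mathbb{R}^{2n+2}$, $u\in\Omega$, given by $dx+\lambda^i dt=0$, $du^i=0$, $du^k+(\lambda^i-\lambda^k)u^k_x\,dt=0$ for $k\ne i$, and $du^i_x-\big(\sum_k u^k_x\partial_k\lambda^i\big)u^i_x\,dt=0$. A Riemann invariant of it is a local first integral. It has an extra Riemann invariant of order $1$ if, near every point, there is a smooth Riemann invariant $I(x,t,u,u_x)$ that is functionally independent of $u^i$ and depends on the derivatives $u_x$. For fixed $i\ne j$, the $ij$-Laplace transformation of the linear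 system for commuting flows $\partial_m\mu^k=a_{km}(\mu^m-\mu^k)$, $k\neq m$, is obtained as follows. Eliminating $\mu^k=\partial_k\mu^i/a_{ik}+\mu^i$, $k\ne i$, gives for $U=\mu^i$ the system $U_{km}+A_{km}U_k+A_{mk}U_m=0$, $k\ne m$, with $A_{im}=a_{im}$ and $A_{km}=a_{km}-\partial_m a_{ik}/a_{ik}$ for $k\ne i$. Setting $\bar\mu^j=U$ and $\bar\mu^k=\partial_kU/A_{jk}+U$ for $k\neq j$ gives $\partial_m\bar\mu^k=\bar a_{km}(\bar\mu^m-\bar\mu^k)$, $k\neq m$, with $\bar a_{jm}=A_{jm}$ and $\bar a_{km}=A_{km}+\partial_mA_{jk}/A_{jk}$ for $k\ne j$. Theorem. Suppose that, for a fixed pair $i\ne j$, everywhere on $\Omega$ all the coefficients $a_{im}$, $m\ne i$, are nonzero, the coefficients $a_{mj}$, $m\neq j$, are pairwise distinct, and $a_{ji}-\partial_ia_{ij}/a_{ij}\neq0$ (so that the $ij$-Laplace transformation is defined). Then the $i$-th Monge characteristic distribution has an extra Riemann invariant of order $1$ if and only if $\bar a_{im}=0$ on $\Omega$ for all $m\neq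 i$. -/

import Mathlib

open scoped ContDiff Topology

namespace Hydro

noncomputable section

/-- Partial derivative `∂_k f` of a function of `u = (u^1, …, u^n)`. -/
def pd {n : ℕ} (k : Fin n) (f : (Fin n → ℝ) → ℝ) (u : Fin n → ℝ) : ℝ :=
  fderiv ℝ f u (Pi.single k 1)

/-- A family of functions `a_{km}(u)`: the coefficients of a linear system
`∂_m μ^k = a_{km} (μ^m - μ^k)`, `k ≠ m`, or of a linear system
`U_{km} + A_{km} U_k + A_{mk} U_m = 0`, `k ≠ m`.
Only the entries with `k ≠ m` are meaningful. -/
abbrev Coeffs (n : ℕ) := Fin n → Fin n → (Fin n → ℝ) → ℝ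

/-- Strict hyperbolicity on `U` of the system `u^i_t = λ^i(u) u^i_x`, `i = 1, …, n`. -/
def StrictlyHyperbolicOn {n : ℕ} (lam : Fin n → (Fin n → ℝ) → ℝ) (U : Set (Fin n → ℝ)) : Prop :=
  ∀ u ∈ U, ∀ i j, i ≠ j → lam i u ≠ lam j u

/-- The functions `a_{ij} = ∂_j λ^i / (λ^j - λ^i)`, `i ≠ j`: the coefficients of the linear system
`∂_j μ^i = a_{ij} (μ^j - μ^i)` for the flows commuting with `u^i_t = λ^i(u) u^i_x`. -/
def commutingCoeffs {n : ℕ} (lam : Fin n → (Fin n → ℝ) → ℝ) : Coeffs n :=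
  fun i j u => pd j (lam i) u / (lam j u - lam i u)

/-- The semihamiltonian property on `U`: `∂_j a_{ik} = ∂_k a_{ij}` for pairwise distinct
`i, j, k`. -/
def SemihamiltonianOn {n : ℕ} (lam : Fin n → (Fin n → ℝ) → ℝ) (U : Set (Fin n → ℝ)) : Prop :=
  ∀ u ∈ U, ∀ i j k, i ≠ j → j ≠ k → i ≠ k →
    pd j (commutingCoeffs lam i k) u = pd k (commutingCoeffs lam i j) u

/-! ### Laplace transformation -/

/-- Coefficients `A_{km}` of the second order system `U_{km} + A_{km} U_k + A_{mk} U_m = 0` for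
`U = μ^i`, obtained from `∂_m μ^k = a_{km} (μ^m - μ^k)` by eliminating
`μ^k = ∂_k μ^i / a_{ik} + μ^i`, `k ≠ i`. -/
def toSecondOrder {n : ℕ} (i : Fin n) (a : Coeffs n) : Coeffs n :=
  fun k m u => if k = i then a i m u else a k m u - pd m (a i k) u / a i k u

/-- Coefficients `a_{km}` of the first order system `∂_m μ^k = a_{km} (μ^m - μ^k)` recovered from
the second order system `U_{km} + A_{km} U_k + A_{mk} U_m = 0` by setting `μ^j = U` and
`μ^k = ∂_k U / A_{jk} + U`, `k ≠ j`. -/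
def ofSecondOrder {n : ℕ} (j : Fin n) (A : Coeffs n) : Coeffs n :=
  fun k m u => if k = j then A j m u else A k m u + pd m (A j k) u / A j k u

/-- Coefficients of the Laplace transformation, for the pair of indices `i, j`, of the system
`∂_m μ^k = a_{km} (μ^m - μ^k)`: pass to the second order system for `U = μ^i`, and return to a
first order system whose `j`-th unknown is `U`. -/
def laplace {n : ℕ} (i j : Fin n) (a : Coeffs n) : Coeffs n :=
  ofSecondOrder j (toSecondOrder i a)

/-! ### Monge characteristic distributions and Riemann invariants -/

/-- The space `ℝ^{2n+2}` with coordinates `(x, t, u, u_x)`. It also serves as its own tangent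
space, with coordinates `(dx, dt, du, du_x)`. -/
abbrev Jet (n : ℕ) := ℝ × ℝ × (Fin n → ℝ) × (Fin n → ℝ)

namespace Jet

variable {n : ℕ}

abbrev x (q : Jet n) : ℝ := q.1
abbrev t (q : Jet n) : ℝ := q.2.1
abbrev u (q : Jet n) : Fin n → ℝ := q.2.2.1
abbrev ux (q : Jet n) : Fin n → ℝ := q.2.2.2

/-- The vector field `∂_{u^k_x}`. -/
def dirUx (k : Fin n) : Jet n := (0, 0, 0, Pi.single k 1)

end Jet

/-- The total derivative `D_x f = ∑_k u^k_x ∂_k f` of a function `f` of `u`. -/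
def totalDx {n : ℕ} (f : (Fin n → ℝ) → ℝ) (q : Jet n) : ℝ := ∑ k, q.ux k * pd k f q.u

/-- The `i`-th Monge characteristic distribution of `u^i_t = λ^i(u) u^i_x` at the point `q`, cut by
`dx + λ^i dt = 0`, `du^i = 0`, `du^j + (λ^i - λ^j) u^j_x dt = 0` for `j ≠ i`, and
`du^i_x - D_x(λ^i) u^i_x dt = 0`. -/
def mongeDistribution {n : ℕ} (lam : Fin n → (Fin n → ℝ) → ℝ) (i : Fin n) (q : Jet n) :
    Submodule ℝ (Jet n) where
  carrier := {X | X.x + lam i q.u * X.t = 0 ∧ X.u i = 0 ∧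
    (∀ j, j ≠ i → X.u j + (lam i q.u - lam j q.u) * q.ux j * X.t = 0) ∧
    X.ux i - totalDx (lam i) q * q.ux i * X.t = 0}
  zero_mem' := by simp [Jet.x, Jet.t, Jet.u, Jet.ux]
  add_mem' := by
    rintro X Y ⟨h1, h2, h3, h4⟩ ⟨k1, k2, k3, k4⟩
    simp only [Jet.x, Jet.t, Jet.u, Jet.ux] at *
    refine ⟨?_, ?_, fun j hj => ?_, ?_⟩ <;>
      simp only [Prod.fst_add, Prod.snd_add, Pi.add_apply]
    · linear_combination h1 + k1
    · linear_combination h2 + k2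
    · linear_combination h3 j hj + k3 j hj
    · linear_combination h4 + k4
  smul_mem' := by
    rintro c X ⟨h1, h2, h3, h4⟩
    simp only [Jet.x, Jet.t, Jet.u, Jet.ux] at *
    refine ⟨?_, ?_, fun j hj => ?_, ?_⟩ <;>
      simp only [Prod.smul_fst, Prod.smul_snd, Pi.smul_apply, smul_eq_mul]
    · linear_combination c * h1
    · linear_combination c * h2
    · linear_combination c * h3 j hj
    · linear_combination c * h4

/-- `I` is, on the open set `W`, a smooth Riemann invariant (first integral) of the `i`-th Monge
characteristic distribution: `dI` annihilates the distribution. -/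
def IsRiemannInvariantOn {n : ℕ} (lam : Fin n → (Fin n → ℝ) → ℝ) (i : Fin n) (W : Set (Jet n))
    (I : Jet n → ℝ) : Prop :=
  ContDiffOn ℝ ∞ I W ∧ ∀ q ∈ W, ∀ X ∈ mongeDistribution lam i q, fderiv ℝ I q X = 0

/-- Near `p`, the function `I` does not depend on the derivatives `u_x` (order `0`). -/
def HasOrderZeroAt {n : ℕ} (I : Jet n → ℝ) (p : Jet n) : Prop :=
  ∀ᶠ q in 𝓝 p, ∀ k, fderiv ℝ I q (Jet.dirUx k) = 0

/-- Near `p`, the `i`-th Monge characteristic distribution has an extra Riemann invariant of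
order `1`: a Riemann invariant that is functionally independent of `u^i` and, as a function of
`x, t, u, u_x`, is not of order `0`. -/
def HasExtraRiemannInvariantOrderOneAt {n : ℕ} (lam : Fin n → (Fin n → ℝ) → ℝ) (i : Fin n)
    (p : Jet n) : Prop :=
  ∃ W : Set (Jet n), IsOpen W ∧ p ∈ W ∧ ∃ I : Jet n → ℝ,
    IsRiemannInvariantOn lam i W I ∧
    LinearIndependent ℝ ![fderiv ℝ (fun q : Jet n => q.u i) p, fderiv ℝ I p] ∧
    ¬ HasOrderZeroAt I p

/-- The `i`-th Monge characteristic distribution of `u^i_t = λ^i(u) u^i_x`, `u ∈ U`, has (locally,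
around every point of the space of `(x, t, u, u_x)` with `u ∈ U`) an extra Riemann invariant of
order `1`. -/
def HasExtraRiemannInvariantOrderOne {n : ℕ} (lam : Fin n → (Fin n → ℝ) → ℝ)
    (U : Set (Fin n → ℝ)) (i : Fin n) : Prop :=
  ∀ p : Jet n, p.u ∈ U → HasExtraRiemannInvariantOrderOneAt lam i p

end

end Hydro

/-!
Write `p = u^i_x`, `a_{km}` for the coefficients of the linear system for commuting flows, and
`A_{ki} = a_{ki} - ∂_i a_{ik} / a_{ik}`, `A = A_{ji}`. By definition `ā_{im} = a_{im} + ∂_m A / A`,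
so the vanishing of all `ā_{im}` means that `∂_m A = -a_{im} A` for `m ≠ i`.

*Necessity.* A Riemann invariant is constant along `∂_{u^k_x}`, `k ≠ i`, and along the remaining
generator `T` of the distribution, hence along all their commutators. The commutators of
`∂_{u^k_x}` with `T` give `∂_k + a_{ik} p ∂_p`, and `T` reduces modulo these to
`∂_t - λ^i ∂_x + ∂_i λ^i p² ∂_p`. Because of `∂_k λ^i A_{ki} = -∂_k ∂_i λ^i - a_{ik} ∂_i λ^i`
(`pd_mul_toSecondOrder`), the commutator of this last field with `∂_j + a_{ij} p ∂_p` is a nonzero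
multiple of `∂_x + A p² ∂_p`. Finally, the commutator with `∂_k + a_{ik} p ∂_p` gives
`(∂_k A + a_{ik} A) p² ∂_p`. An invariant that depends on `p` therefore forces
`∂_k A + a_{ik} A = 0`, at first where `p ≠ 0` and the invariant depends on `p`, and then everywhere
by continuity.

*Sufficiency.* The compatibility conditions of the linear system give
`(∂_k A + a_{ik} A) a_{ij} = a_{ik} (A - A_{ki}) (a_{ij} - a_{kj})` for `k ≠ i, j`
(`pd_toSecondOrder_add`), so that `A_{ki} = A` for all `k ≠ i`, as the `a_{mj}` are distinct. Then
`s = ∂_i λ^i + A λ^i` satisfies `∂_k s = -a_{ik} s` as well, and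
`A p / (1 + p (A x + s t))` is an invariant: along the distribution, numerator and denominator are
multiplied by the same factor (`fderiv_inv_of_mem`). Where the denominator vanishes, the inverse of
this function serves.
-/

namespace Hydro

noncomputable section

variable {n : ℕ}

/-! ### Partial derivatives of smooth functions on an open set -/

section Calculus

variable {U : Set (Fin n → ℝ)} {f g : (Fin n → ℝ) → ℝ} {u : Fin n → ℝ}

theorem fderiv_single (f : (Fin n → ℝ) → ℝ) (u : Fin n → ℝ) (k : Fin n) :
    fderiv ℝ f u (Pi.single k 1) = pd k f u := rfl

theorem differentiableAt_of_contDiffOn (hU : IsOpen U) (hf : ContDiffOn ℝ ∞ f U) (hu : u ∈ U) :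
    DifferentiableAt ℝ f u :=
  (hf.contDiffAt (hU.mem_nhds hu)).differentiableAt (by simp)

theorem contDiffOn_pd (hU : IsOpen U) (hf : ContDiffOn ℝ ∞ f U) (k : Fin n) :
    ContDiffOn ℝ ∞ (pd k f) U :=
  (hf.fderiv_of_isOpen hU (m := ∞) (by simp)).clm_apply contDiffOn_const

theorem pd_congr (hU : IsOpen U) (h : ∀ v ∈ U, f v = g v) (hu : u ∈ U) (k : Fin n) :
    pd k f u = pd k g u := by
  have : f =ᶠ[𝓝 u] g := Filter.eventuallyEq_of_mem (hU.mem_nhds hu) h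
  simp only [pd, this.fderiv_eq]

theorem pd_add (hf : DifferentiableAt ℝ f u) (hg : DifferentiableAt ℝ g u) (k : Fin n) :
    pd k (fun v => f v + g v) u = pd k f u + pd k g u := by
  simp [pd, fderiv_fun_add hf hg]

theorem pd_sub (hf : DifferentiableAt ℝ f u) (hg : DifferentiableAt ℝ g u) (k : Fin n) :
    pd k (fun v => f v - g v) u = pd k f u - pd k g u := by
  simp [pd, fderiv_fun_sub hf hg]

theorem pd_mul (hf : DifferentiableAt ℝ f u) (hg : DifferentiableAt ℝ g u) (k : Fin n) :
    pd k (fun v => f v * g v) u = f u * pd k g u + g u * pd k f u := by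
  simp [pd, fderiv_fun_mul hf hg]

theorem pd_comm (hU : IsOpen U) (hf : ContDiffOn ℝ ∞ f U) (hu : u ∈ U) (k m : Fin n) :
    pd k (pd m f) u = pd m (pd k f) u := by
  have hfu := hf.contDiffAt (hU.mem_nhds hu)
  have hd : DifferentiableAt ℝ (fderiv ℝ f) u :=
    (hfu.fderiv_right (m := ∞) (by simp)).differentiableAt (by simp)
  have key : ∀ a b : Fin n, pd a (pd b f) u
      = fderiv ℝ (fderiv ℝ f) u (Pi.single a 1) (Pi.single b 1) := by
    intro a b
    change fderiv ℝ (fun v => fderiv ℝ f v (Pi.single b 1)) u (Pi.single a 1) = _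
    rw [fderiv_clm_apply hd (differentiableAt_const _)]
    simp
  rw [key, key]
  exact (hfu.isSymmSndFDerivAt (by
    rw [minSmoothness_of_isRCLikeNormedField]; exact ENat.LEInfty.out)).eq _ _

theorem fderiv_eq_sum_pd (f : (Fin n → ℝ) → ℝ) (u v : Fin n → ℝ) :
    fderiv ℝ f u v = ∑ k, v k * pd k f u := by
  conv_lhs => rw [← Finset.univ_sum_single v]
  rw [map_sum]
  refine Finset.sum_congr rfl fun k _ => ?_
  have : (Pi.single k (v k) : Fin n → ℝ) = v k • Pi.single k 1 := by
    rw [← Pi.single_smul, smul_eq_mul, mul_one]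
  rw [this, map_smul, smul_eq_mul, pd]

end Calculus

/-! ### Coefficients of the linear systems -/

section Coefficients

variable {U : Set (Fin n → ℝ)} {lam : Fin n → (Fin n → ℝ) → ℝ} {u : Fin n → ℝ}

theorem contDiffOn_commutingCoeffs (hU : IsOpen U) (hlam : ∀ k, ContDiffOn ℝ ∞ (lam k) U)
    (hhyp : StrictlyHyperbolicOn lam U) {k m : Fin n} (hkm : k ≠ m) :
    ContDiffOn ℝ ∞ (commutingCoeffs lam k m) U :=
  (contDiffOn_pd hU (hlam k) m).div ((hlam m).sub (hlam k))
    fun u hu => sub_ne_zero.2 (hhyp u hu m k hkm.symm)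

theorem pd_eq_commutingCoeffs_mul (hhyp : StrictlyHyperbolicOn lam U) (hu : u ∈ U) {k m : Fin n}
    (hkm : k ≠ m) : pd m (lam k) u = commutingCoeffs lam k m u * (lam m u - lam k u) := by
  rw [commutingCoeffs, div_mul_cancel₀ _ (sub_ne_zero.2 (hhyp u hu m k hkm.symm))]

/-- Differentiating `∂_m λ^k = a_{km} (λ^m - λ^k)`. -/
theorem pd_pd_eq (hU : IsOpen U) (hlam : ∀ k, ContDiffOn ℝ ∞ (lam k) U)
    (hhyp : StrictlyHyperbolicOn lam U) (hu : u ∈ U) {k m : Fin n} (hkm : k ≠ m) (l : Fin n) :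
    pd l (pd m (lam k)) u = commutingCoeffs lam k m u * (pd l (lam m) u - pd l (lam k) u) +
      (lam m u - lam k u) * pd l (commutingCoeffs lam k m) u := by
  have hd := fun k => differentiableAt_of_contDiffOn hU (hlam k) hu
  rw [pd_congr hU (fun v hv => pd_eq_commutingCoeffs_mul hhyp hv hkm) hu,
    pd_mul (differentiableAt_of_contDiffOn hU (contDiffOn_commutingCoeffs hU hlam hhyp hkm) hu)
      ((hd m).fun_sub (hd k)), pd_sub (hd m) (hd k)]

/-- The compatibility conditions of `∂_m μ^k = a_{km} (μ^m - μ^k)` in their full form: symmetry of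
`∂_m a_{kl}` in `l, m` determines its value, because `∂_m ∂_l λ^k = ∂_l ∂_m λ^k`. -/
theorem pd_commutingCoeffs (hU : IsOpen U) (hlam : ∀ k, ContDiffOn ℝ ∞ (lam k) U)
    (hhyp : StrictlyHyperbolicOn lam U) (hsemi : SemihamiltonianOn lam U) (hu : u ∈ U)
    {k l m : Fin n} (hkl : k ≠ l) (hkm : k ≠ m) (hlm : l ≠ m) :
    pd m (commutingCoeffs lam k l) u =
      commutingCoeffs lam k l u * commutingCoeffs lam l m u +
      commutingCoeffs lam k m u * commutingCoeffs lam m l u -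
      commutingCoeffs lam k m u * commutingCoeffs lam k l u := by
  have h1 := pd_pd_eq hU hlam hhyp hu hkl m
  have h2 := pd_pd_eq hU hlam hhyp hu hkm l
  rw [pd_comm hU (hlam k) hu l m, h1, hsemi u hu k l m hkl hlm hkm] at h2
  rw [pd_eq_commutingCoeffs_mul hhyp hu hlm, pd_eq_commutingCoeffs_mul hhyp hu hkm,
    pd_eq_commutingCoeffs_mul hhyp hu hlm.symm, pd_eq_commutingCoeffs_mul hhyp hu hkl] at h2
  refine mul_left_cancel₀ (sub_ne_zero.2 (hhyp u hu l m hlm)) ?_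
  linear_combination h2

theorem toSecondOrder_of_ne {i k m : Fin n} (hk : k ≠ i) (a : Coeffs n) :
    toSecondOrder i a k m = fun u => a k m u - pd m (a i k) u / a i k u := by
  funext u
  simp [toSecondOrder, hk]

/-- In terms of the coefficients `A_{km}` of the second order system for `μ^i`, the coefficients
`ā_{im}` of the Laplace transformation are `a_{im} + ∂_m A_{ji} / A_{ji}`. -/
theorem laplace_apply_left {i j : Fin n} (hij : i ≠ j) (a : Coeffs n) (m : Fin n)
    (u : Fin n → ℝ) : laplace i j a i m u =
      a i m u + pd m (toSecondOrder i a j i) u / toSecondOrder i a j i u := by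
  simp only [laplace, ofSecondOrder, if_neg hij]
  simp [toSecondOrder]

theorem contDiffOn_toSecondOrder (hU : IsOpen U) (hlam : ∀ k, ContDiffOn ℝ ∞ (lam k) U)
    (hhyp : StrictlyHyperbolicOn lam U) {i k : Fin n} (hki : k ≠ i)
    (ha : ∀ u ∈ U, commutingCoeffs lam i k u ≠ 0) :
    ContDiffOn ℝ ∞ (toSecondOrder i (commutingCoeffs lam) k i) U := by
  rw [toSecondOrder_of_ne hki]
  have h := contDiffOn_commutingCoeffs hU hlam hhyp hki.symm
  exact (contDiffOn_commutingCoeffs hU hlam hhyp hki).sub ((contDiffOn_pd hU h i).div h ha)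

theorem toSecondOrder_mul (hki : k ≠ i) {a : Coeffs n} (ha : a i k u ≠ 0) :
    toSecondOrder i a k i u * a i k u = a k i u * a i k u - pd i (a i k) u := by
  rw [toSecondOrder_of_ne hki]
  field_simp

/-- The coefficient `A_{ki}` through the second derivative `∂_k ∂_i λ^i`. -/
theorem pd_mul_toSecondOrder (hU : IsOpen U) (hlam : ∀ k, ContDiffOn ℝ ∞ (lam k) U)
    (hhyp : StrictlyHyperbolicOn lam U) {i k : Fin n} (hki : k ≠ i) (hu : u ∈ U)
    (ha : commutingCoeffs lam i k u ≠ 0) :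
    pd k (lam i) u * toSecondOrder i (commutingCoeffs lam) k i u =
      -pd k (pd i (lam i)) u - commutingCoeffs lam i k u * pd i (lam i) u := by
  have h1 := toSecondOrder_mul hki ha
  have h2 := pd_pd_eq hU hlam hhyp hu hki.symm i
  have h3 := pd_eq_commutingCoeffs_mul hhyp hu hki
  have h4 := pd_eq_commutingCoeffs_mul hhyp hu hki.symm
  rw [pd_comm hU (hlam i) hu k i]
  linear_combination (lam k u - lam i u) * h1 + toSecondOrder i (commutingCoeffs lam) k i u * h4
    + h2 + commutingCoeffs lam i k u * h3

/-- The coefficient `ā_{ik}` of the Laplace transformation, up to nonzero factors, is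
`(A_{ji} - A_{ki}) (a_{ij} - a_{kj})`. It is the compatibility conditions that allow
`∂_k A_{ji}`, a third derivative of `λ`, to be eliminated. -/
theorem pd_toSecondOrder_add (hU : IsOpen U) (hlam : ∀ k, ContDiffOn ℝ ∞ (lam k) U)
    (hhyp : StrictlyHyperbolicOn lam U) (hsemi : SemihamiltonianOn lam U)
    {i j k : Fin n} (hij : i ≠ j) (hki : k ≠ i) (hkj : k ≠ j)
    (ha : ∀ u ∈ U, ∀ m, m ≠ i → commutingCoeffs lam i m u ≠ 0) (hu : u ∈ U) :
    (pd k (toSecondOrder i (commutingCoeffs lam) j i) u +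
      commutingCoeffs lam i k u * toSecondOrder i (commutingCoeffs lam) j i u) *
        commutingCoeffs lam i j u =
    commutingCoeffs lam i k u * (toSecondOrder i (commutingCoeffs lam) j i u -
      toSecondOrder i (commutingCoeffs lam) k i u) *
        (commutingCoeffs lam i j u - commutingCoeffs lam k j u) := by
  have hs := contDiffOn_toSecondOrder hU hlam hhyp hij.symm fun u hu => ha u hu j hij.symm
  have hA := fun v (hv : v ∈ U) => toSecondOrder_mul hij.symm (ha v hv j hij.symm)
  have hB := toSecondOrder_mul hki (ha u hu k hki)
  have hkc := fun v (hv : v ∈ U) => pd_commutingCoeffs hU hlam hhyp hsemi hv hij hki.symm hkj.symm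
  have hk_ji := hsemi u hu j k i hkj.symm hki hij.symm
  have hi_kj := pd_commutingCoeffs hU hlam hhyp hsemi hu hkj hki hij.symm
  have hc : ∀ {p q : Fin n}, p ≠ q → DifferentiableAt ℝ (commutingCoeffs lam p q) u := fun h =>
    differentiableAt_of_contDiffOn hU (contDiffOn_commutingCoeffs hU hlam hhyp h) hu
  have hAk := pd_congr hU hA hu k
  have hki' := pd_congr hU hkc hu i
  rw [pd_mul (differentiableAt_of_contDiffOn hU hs hu) (hc hij),
    pd_sub ((hc hij.symm).fun_mul (hc hij)) (differentiableAt_of_contDiffOn hU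
      (contDiffOn_pd hU (contDiffOn_commutingCoeffs hU hlam hhyp hij) i) hu),
    pd_mul (hc hij.symm) (hc hij),
    pd_comm hU (contDiffOn_commutingCoeffs hU hlam hhyp hij) hu] at hAk
  rw [pd_sub (((hc hij).fun_mul (hc hkj.symm)).fun_add ((hc hki.symm).fun_mul (hc hkj)))
      ((hc hki.symm).fun_mul (hc hij)),
    pd_add ((hc hij).fun_mul (hc hkj.symm)) ((hc hki.symm).fun_mul (hc hkj)),
    pd_mul (hc hij) (hc hkj.symm), pd_mul (hc hki.symm) (hc hkj), pd_mul (hc hki.symm) (hc hij)]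
    at hki'
  have hk_ij := hkc u hu
  have hAu := hA u hu
  linear_combination hAk - hki' + (commutingCoeffs lam j i u -
    toSecondOrder i (commutingCoeffs lam) j i u) * hk_ij + commutingCoeffs lam i j u * hk_ji
    - commutingCoeffs lam i k u * hi_kj
    + (commutingCoeffs lam i k u - commutingCoeffs lam j k u) * hAu
    + (commutingCoeffs lam i j u - commutingCoeffs lam k j u) * hB

end Coefficients

/-! ### Vector fields on the jet space -/

/-- If `f` is constant along the vector fields `X` and `Y`, it is constant along their
commutator. -/
theorem fderiv_commutator_eq_zero {E : Type*} [NormedAddCommGroup E] [NormedSpace ℝ E]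
    {f : E → ℝ} {X Y : E → E} {X' Y' : E →L[ℝ] E} {q : E} (hf : ContDiffAt ℝ ∞ f q)
    (hX : ∀ᶠ q' in 𝓝 q, fderiv ℝ f q' (X q') = 0) (hY : ∀ᶠ q' in 𝓝 q, fderiv ℝ f q' (Y q') = 0)
    (hX' : HasFDerivAt X X' q) (hY' : HasFDerivAt Y Y' q) :
    fderiv ℝ f q (Y' (X q) - X' (Y q)) = 0 := by
  have hd : HasFDerivAt (fderiv ℝ f) (fderiv ℝ (fderiv ℝ f) q) q :=
    ((hf.fderiv_right (m := ∞) (by simp)).differentiableAt (by simp)).hasFDerivAt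
  have key : ∀ {Z : E → E} {Z' : E →L[ℝ] E}, HasFDerivAt Z Z' q →
      (∀ᶠ q' in 𝓝 q, fderiv ℝ f q' (Z q') = 0) → ∀ v,
      fderiv ℝ f q (Z' v) + fderiv ℝ (fderiv ℝ f) q v (Z q) = 0 := by
    intro Z Z' hZ' hZ v
    have h1 := hd.clm_apply hZ'
    have h2 : HasFDerivAt (fun q' => fderiv ℝ f q' (Z q')) (0 : E →L[ℝ] ℝ) q :=
      (hasFDerivAt_const (0 : ℝ) q).congr_of_eventuallyEq hZ
    simpa using congrArg (fun L : E →L[ℝ] ℝ => L v) (h1.unique h2)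
  have hsymm : fderiv ℝ (fderiv ℝ f) q (X q) (Y q) = fderiv ℝ (fderiv ℝ f) q (Y q) (X q) :=
    (hf.isSymmSndFDerivAt (by
      rw [minSmoothness_of_isRCLikeNormedField]; exact ENat.LEInfty.out)).eq _ _
  have h1 := key hY' hY (X q)
  have h2 := key hX' hX (Y q)
  rw [map_sub]
  linear_combination h1 - h2 - hsymm

namespace Jet

/-- The vector field `∂_x`. -/
def dirX : Jet n := (1, 0, 0, 0)

/-- The vector field `∂_t`. -/
def dirT : Jet n := (0, 1, 0, 0)

/-- The vector field `∂_{u^k}`. -/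
def dirU (k : Fin n) : Jet n := (0, 0, Pi.single k 1, 0)

theorem map_eq_sum (L : Jet n →L[ℝ] ℝ) (v : Jet n) :
    L v = v.x * L dirX + v.t * L dirT + ∑ k, v.u k * L (dirU k) + ∑ k, v.ux k * L (dirUx k) := by
  have h : ∀ M : (Fin n → ℝ) →L[ℝ] ℝ, ∀ w, M w = ∑ k, w k * M (Pi.single k 1) := by
    intro M w
    simpa [pd] using fderiv_eq_sum_pd M 0 w
  have hv : v = v.x • dirX + v.t • dirT + (0, 0, v.u, 0) + (0, 0, 0, v.ux) := by
    simp [dirX, dirT, Jet.x, Jet.t, Jet.u, Jet.ux]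
  have hu := h (L.comp ((ContinuousLinearMap.inr ℝ ℝ _).comp ((ContinuousLinearMap.inr ℝ ℝ _).comp
    (ContinuousLinearMap.inl ℝ (Fin n → ℝ) (Fin n → ℝ))))) v.u
  have hux := h (L.comp ((ContinuousLinearMap.inr ℝ ℝ _).comp ((ContinuousLinearMap.inr ℝ ℝ _).comp
    (ContinuousLinearMap.inr ℝ (Fin n → ℝ) (Fin n → ℝ))))) v.ux
  simp only [ContinuousLinearMap.comp_apply, ContinuousLinearMap.inr_apply,
    ContinuousLinearMap.inl_apply] at hu hux
  conv_lhs => rw [hv]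
  rw [map_add, map_add, map_add, map_smul, map_smul]
  erw [hu, hux]
  rfl

/-- The coordinate `u` as a continuous linear map. -/
def uL : Jet n →L[ℝ] (Fin n → ℝ) :=
  (ContinuousLinearMap.fst ℝ _ _).comp
    ((ContinuousLinearMap.snd ℝ _ _).comp (ContinuousLinearMap.snd ℝ _ _))

/-- The coordinate `u^i_x` as a continuous linear map. -/
def uxL (i : Fin n) : Jet n →L[ℝ] ℝ :=
  (ContinuousLinearMap.proj i).comp ((ContinuousLinearMap.snd ℝ _ _).comp
    ((ContinuousLinearMap.snd ℝ _ _).comp (ContinuousLinearMap.snd ℝ _ _)))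

@[simp] theorem uL_apply (q : Jet n) : uL q = q.u := rfl

@[simp] theorem uxL_apply (i : Fin n) (q : Jet n) : uxL i q = q.ux i := rfl

theorem hasFDerivAt_comp_u {f : (Fin n → ℝ) → ℝ} {q : Jet n} (hf : DifferentiableAt ℝ f q.u) :
    HasFDerivAt (fun q : Jet n => f q.u) ((fderiv ℝ f q.u).comp uL) q :=
  HasFDerivAt.comp (f := uL) q hf.hasFDerivAt uL.hasFDerivAt

theorem hasFDerivAt_ux (i : Fin n) (q : Jet n) :
    HasFDerivAt (fun q : Jet n => q.ux i) (uxL i) q := (uxL i).hasFDerivAt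

/-- The vector field `e + f(u) ∂_x + b(u) (u^i_x)^m ∂_{u^i_x}`. -/
def field (i : Fin n) (e : Jet n) (f b : (Fin n → ℝ) → ℝ) (m : ℕ) (q : Jet n) : Jet n :=
  e + f q.u • dirX + (b q.u * q.ux i ^ m) • dirUx i

@[simp] theorem dirX_u : (dirX : Jet n).u = 0 := rfl
@[simp] theorem dirX_ux : (dirX : Jet n).ux = 0 := rfl
@[simp] theorem dirT_u : (dirT : Jet n).u = 0 := rfl
@[simp] theorem dirT_ux : (dirT : Jet n).ux = 0 := rfl
@[simp] theorem dirU_u (k : Fin n) : (dirU k).u = Pi.single k 1 := rfl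
@[simp] theorem dirU_ux (k : Fin n) : (dirU k).ux = 0 := rfl

theorem field_u (i : Fin n) (e : Jet n) (f b : (Fin n → ℝ) → ℝ) (m : ℕ) (q : Jet n) :
    (field i e f b m q).u = e.u := by
  simp [field, Jet.u, dirX, dirUx]

theorem field_ux (i : Fin n) (e : Jet n) (f b : (Fin n → ℝ) → ℝ) (m : ℕ) (q : Jet n) :
    (field i e f b m q).ux i = e.ux i + b q.u * q.ux i ^ m := by
  simp [field, Jet.ux, dirX, dirUx]

theorem hasFDerivAt_field (i : Fin n) (e : Jet n) {f b : (Fin n → ℝ) → ℝ} (m : ℕ) {q : Jet n}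
    (hf : DifferentiableAt ℝ f q.u) (hb : DifferentiableAt ℝ b q.u) :
    ∃ L : Jet n →L[ℝ] Jet n, HasFDerivAt (field i e f b m) L q ∧
      ∀ v : Jet n, L v = fderiv ℝ f q.u v.u • dirX + (fderiv ℝ b q.u v.u * q.ux i ^ m +
        b q.u * (m * q.ux i ^ (m - 1) * v.ux i)) • dirUx i := by
  refine ⟨_, (((hasFDerivAt_comp_u hf).smul_const dirX).const_add e).add
    (((hasFDerivAt_comp_u hb).mul ((hasFDerivAt_ux i q).pow m)).smul_const (dirUx i)), ?_⟩
  intro v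
  simp
  ring_nf

end Jet

/-! ### First integrals of the Monge characteristic distribution -/

/-- The vector field of the `i`-th Monge characteristic distribution with `dt = 1` and
`du^k_x = 0` for `k ≠ i`; together with `∂_{u^k_x}`, `k ≠ i`, it spans the distribution. -/
def mongeField (lam : Fin n → (Fin n → ℝ) → ℝ) (i : Fin n) (q : Jet n) : Jet n :=
  (-lam i q.u, 1, fun k => (lam k q.u - lam i q.u) * q.ux k,
    (totalDx (lam i) q * q.ux i) • Pi.single i 1)

theorem mongeField_mem (lam : Fin n → (Fin n → ℝ) → ℝ) (i : Fin n) (q : Jet n) :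
    mongeField lam i q ∈ mongeDistribution lam i q := by
  change _ ∧ _ ∧ _ ∧ _
  simp only [mongeField, Jet.x, Jet.t, Jet.u, Jet.ux]
  refine ⟨by ring, by ring, fun k _ => by ring, by simp⟩

theorem dirUx_mem (lam : Fin n → (Fin n → ℝ) → ℝ) {i k : Fin n} (hki : k ≠ i) (q : Jet n) :
    Jet.dirUx k ∈ mongeDistribution lam i q := by
  change _ ∧ _ ∧ _ ∧ _
  simp [Jet.dirUx, Jet.x, Jet.t, Jet.u, Jet.ux, hki.symm]

section Integrals

variable {U : Set (Fin n → ℝ)} {lam : Fin n → (Fin n → ℝ) → ℝ}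

theorem hasFDerivAt_mongeField (hU : IsOpen U) (hlam : ∀ k, ContDiffOn ℝ ∞ (lam k) U)
    (i : Fin n) {q : Jet n} (hq : q.u ∈ U) :
    ∃ L : Jet n →L[ℝ] Jet n, HasFDerivAt (mongeField lam i) L q ∧
      ∀ k, k ≠ i → L (Jet.dirUx k) = (lam k q.u - lam i q.u) • Jet.dirU k +
        (pd k (lam i) q.u * q.ux i) • Jet.dirUx i := by
  have hd : ∀ {f : (Fin n → ℝ) → ℝ}, ContDiffOn ℝ ∞ f U →
      DifferentiableAt ℝ (fun q : Jet n => f q.u) q := fun h =>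
    (Jet.hasFDerivAt_comp_u (differentiableAt_of_contDiffOn hU h hq)).differentiableAt
  have hux : ∀ k, DifferentiableAt ℝ (fun q : Jet n => q.ux k) q := fun k =>
    (Jet.hasFDerivAt_ux k q).differentiableAt
  have hT : DifferentiableAt ℝ (totalDx (lam i)) q := by
    unfold totalDx
    exact DifferentiableAt.fun_sum fun k _ => (hux k).mul (hd (contDiffOn_pd hU (hlam i) k))
  have hM : DifferentiableAt ℝ (mongeField lam i) q := by
    refine (hd (hlam i)).neg.prodMk ((differentiableAt_const _).prodMk
      (DifferentiableAt.prodMk (differentiableAt_pi.2 fun k => ?_) ?_))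
    · exact ((hd (hlam k)).sub (hd (hlam i))).mul (hux k)
    · exact (hT.mul (hux i)).smul_const _
  refine ⟨_, hM.hasFDerivAt, fun k hki => ?_⟩
  rw [← hM.lineDeriv_eq_fderiv]
  set w : Jet n := (lam k q.u - lam i q.u) • Jet.dirU k +
    (pd k (lam i) q.u * q.ux i) • Jet.dirUx i with hw
  -- the field is affine along the line in the direction `∂_{u^k_x}`
  have hline : ∀ s : ℝ, mongeField lam i (q + s • Jet.dirUx k) = mongeField lam i q + s • w := by
    intro s
    have hu : (q + s • Jet.dirUx k).u = q.u := by simp [Jet.dirUx, Jet.u]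
    have hx : ∀ l, (q + s • Jet.dirUx k).ux l = q.ux l + s * (Pi.single k 1 : Fin n → ℝ) l := by
      intro l; simp [Jet.dirUx, Jet.ux]
    have ht : totalDx (lam i) (q + s • Jet.dirUx k)
        = totalDx (lam i) q + s * pd k (lam i) q.u := by
      simp only [totalDx, hu, hx, add_mul, Finset.sum_add_distrib]
      congr 1
      rw [Finset.sum_eq_single k] <;> simp +contextual
    rw [mongeField, ht, hu]
    simp only [hx]
    refine Prod.ext ?_ (Prod.ext ?_ (Prod.ext ?_ ?_))
    · simp [mongeField, hw, Jet.dirU, Jet.dirUx]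
    · simp [mongeField, hw, Jet.dirU, Jet.dirUx]
    · funext l
      by_cases hl : l = k
      · subst hl
        simp [mongeField, hw, Jet.dirU, Jet.dirUx]
        ring
      · simp [mongeField, hw, Jet.dirU, Jet.dirUx, hl]
    · funext l
      simp [mongeField, hw, Jet.dirU, Jet.dirUx, hki.symm]
      ring
  have : HasLineDerivAt ℝ (mongeField lam i) w q (Jet.dirUx k) := by
    unfold HasLineDerivAt
    simp only [hline]
    simpa using ((hasDerivAt_id (0 : ℝ)).smul_const w).const_add (mongeField lam i q)
  exact this.lineDeriv

variable {W : Set (Jet n)} {I : Jet n → ℝ} {i j : Fin n} {q : Jet n}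

/-- The commutator of `∂_{u^k_x}` and `mongeField`. -/
theorem IsRiemannInvariantOn.fderiv_field_u (hU : IsOpen U)
    (hlam : ∀ k, ContDiffOn ℝ ∞ (lam k) U) (hhyp : StrictlyHyperbolicOn lam U) (hW : IsOpen W)
    (hWU : ∀ q ∈ W, q.u ∈ U) (hI : IsRiemannInvariantOn lam i W I) {k : Fin n} (hki : k ≠ i)
    (hq : q ∈ W) :
    fderiv ℝ I q (Jet.field i (Jet.dirU k) 0 (commutingCoeffs lam i k) 1 q) = 0 := by
  obtain ⟨L, hL, hLk⟩ := hasFDerivAt_mongeField hU hlam i (hWU q hq)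
  have h := fderiv_commutator_eq_zero (hI.1.contDiffAt (hW.mem_nhds hq))
    (Filter.eventually_of_mem (hW.mem_nhds hq) fun q' hq' => hI.2 q' hq' _ (dirUx_mem lam hki q'))
    (Filter.eventually_of_mem (hW.mem_nhds hq) fun q' hq' => hI.2 q' hq' _
      (mongeField_mem lam i q')) (hasFDerivAt_const _ q) hL
  have hne := sub_ne_zero.2 (hhyp _ (hWU q hq) k i hki)
  rw [hLk k hki, _root_.zero_apply, sub_zero] at h
  refine mul_left_cancel₀ hne ?_
  rw [mul_zero, ← h, ← smul_eq_mul, ← map_smul, Jet.field,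
    pd_eq_commutingCoeffs_mul hhyp (hWU q hq) hki.symm]
  congr 1
  simp only [Pi.zero_apply, zero_smul, add_zero, smul_add, smul_smul, pow_one]
  congr 2
  ring

/-- Subtracting from `mongeField` its components along the fields of
`IsRiemannInvariantOn.fderiv_field_u` leaves `∂_t - λ^i ∂_x + ∂_i λ^i (u^i_x)^2 ∂_{u^i_x}`. -/
theorem IsRiemannInvariantOn.fderiv_field_t (hU : IsOpen U)
    (hlam : ∀ k, ContDiffOn ℝ ∞ (lam k) U) (hhyp : StrictlyHyperbolicOn lam U) (hW : IsOpen W)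
    (hWU : ∀ q ∈ W, q.u ∈ U) (hI : IsRiemannInvariantOn lam i W I) (hq : q ∈ W) :
    fderiv ℝ I q (Jet.field i Jet.dirT (fun u => -lam i u) (pd i (lam i)) 2 q) = 0 := by
  have hT := hI.2 q hq _ (mongeField_mem lam i q)
  rw [Jet.map_eq_sum] at hT
  have hu : ∑ k, (mongeField lam i q).u k * fderiv ℝ I q (Jet.dirU k) =
      -(totalDx (lam i) q - q.ux i * pd i (lam i) q.u) * q.ux i *
        fderiv ℝ I q (Jet.dirUx i) := by
    have : q.ux i * pd i (lam i) q.u = ∑ k, if k = i then q.ux k * pd k (lam i) q.u else 0 := by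
      simp
    rw [this, totalDx, ← Finset.sum_sub_distrib, ← Finset.sum_neg_distrib, Finset.sum_mul,
      Finset.sum_mul]
    refine Finset.sum_congr rfl fun k _ => ?_
    by_cases hki : k = i
    · subst hki
      simp [mongeField, Jet.u]
    · have h := hI.fderiv_field_u hU hlam hhyp hW hWU hki hq
      simp only [Jet.field, Pi.zero_apply, zero_smul, add_zero, map_add, map_smul, smul_eq_mul,
        pow_one] at h
      rw [if_neg hki, pd_eq_commutingCoeffs_mul hhyp (hWU q hq) (Ne.symm hki)]
      simp only [mongeField, Jet.u] at h ⊢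
      linear_combination (lam k q.2.2.1 - lam i q.2.2.1) * q.ux k * h
  have hux : ∑ k, (mongeField lam i q).ux k * fderiv ℝ I q (Jet.dirUx k) =
      totalDx (lam i) q * q.ux i * fderiv ℝ I q (Jet.dirUx i) := by
    rw [Finset.sum_eq_single i] <;> simp +contextual [mongeField, Jet.ux]
  rw [hu, hux] at hT
  simp only [mongeField, Jet.x, Jet.t] at hT
  simp only [Jet.field, map_add, map_smul, smul_eq_mul]
  linear_combination hT

/-- The commutator of the fields of `IsRiemannInvariantOn.fderiv_field_u` and
`IsRiemannInvariantOn.fderiv_field_t`. -/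
theorem IsRiemannInvariantOn.fderiv_field_x (hU : IsOpen U)
    (hlam : ∀ k, ContDiffOn ℝ ∞ (lam k) U) (hhyp : StrictlyHyperbolicOn lam U) (hW : IsOpen W)
    (hWU : ∀ q ∈ W, q.u ∈ U) (hI : IsRiemannInvariantOn lam i W I) (hij : i ≠ j)
    (ha : ∀ u ∈ U, commutingCoeffs lam i j u ≠ 0) (hq : q ∈ W) :
    fderiv ℝ I q (Jet.field i Jet.dirX 0 (toSecondOrder i (commutingCoeffs lam) j i) 2 q) = 0 := by
  have hqU := hWU q hq
  obtain ⟨L, hL, hLv⟩ := Jet.hasFDerivAt_field i (Jet.dirU j) 1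
    (differentiableAt_const (0 : ℝ)) (differentiableAt_of_contDiffOn hU
      (contDiffOn_commutingCoeffs hU hlam hhyp hij) hqU)
  obtain ⟨M, hM, hMv⟩ := Jet.hasFDerivAt_field i Jet.dirT 2
    (differentiableAt_of_contDiffOn hU (hlam i).neg hqU)
    (differentiableAt_of_contDiffOn hU (contDiffOn_pd hU (hlam i) i) hqU)
  have h := fderiv_commutator_eq_zero (hI.1.contDiffAt (hW.mem_nhds hq))
    (Filter.eventually_of_mem (hW.mem_nhds hq) fun q' hq' =>
      hI.fderiv_field_u hU hlam hhyp hW hWU hij.symm hq')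
    (Filter.eventually_of_mem (hW.mem_nhds hq) fun q' hq' =>
      hI.fderiv_field_t hU hlam hhyp hW hWU hq') hL hM
  have key := pd_mul_toSecondOrder hU hlam hhyp hij.symm hqU (ha _ hqU)
  have hne : pd j (lam i) q.u ≠ 0 := by
    rw [pd_eq_commutingCoeffs_mul hhyp hqU hij]
    exact mul_ne_zero (ha _ hqU) (sub_ne_zero.2 (hhyp _ hqU j i hij.symm))
  refine mul_left_cancel₀ hne ?_
  rw [hLv, hMv, Jet.field_u, Jet.field_u, Jet.field_ux, Jet.field_ux] at h
  simp only [Jet.dirT_u, Jet.dirT_ux, Jet.dirU_u, Jet.dirU_ux, fderiv_fun_neg, neg_apply, map_zero,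
    map_sub, map_add, map_smul, smul_eq_mul, fderiv_single, Pi.zero_apply,
    Jet.field, zero_smul] at h ⊢
  norm_num at h
  linear_combination -h + q.ux i ^ 2 * fderiv ℝ I q (Jet.dirUx i) * key

/-- The commutator of the fields of `IsRiemannInvariantOn.fderiv_field_u` and
`IsRiemannInvariantOn.fderiv_field_x` is a multiple of `∂_{u^i_x}`. -/
theorem IsRiemannInvariantOn.fderiv_dirUx (hU : IsOpen U)
    (hlam : ∀ k, ContDiffOn ℝ ∞ (lam k) U) (hhyp : StrictlyHyperbolicOn lam U) (hW : IsOpen W)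
    (hWU : ∀ q ∈ W, q.u ∈ U) (hI : IsRiemannInvariantOn lam i W I) (hij : i ≠ j)
    (ha : ∀ u ∈ U, commutingCoeffs lam i j u ≠ 0) {k : Fin n} (hki : k ≠ i) (hq : q ∈ W) :
    (pd k (toSecondOrder i (commutingCoeffs lam) j i) q.u +
      commutingCoeffs lam i k q.u * toSecondOrder i (commutingCoeffs lam) j i q.u) *
      q.ux i ^ 2 * fderiv ℝ I q (Jet.dirUx i) = 0 := by
  have hqU := hWU q hq
  obtain ⟨L, hL, hLv⟩ := Jet.hasFDerivAt_field i (Jet.dirU k) 1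
    (differentiableAt_const (0 : ℝ)) (differentiableAt_of_contDiffOn hU
      (contDiffOn_commutingCoeffs hU hlam hhyp hki.symm) hqU)
  obtain ⟨M, hM, hMv⟩ := Jet.hasFDerivAt_field i Jet.dirX 2
    (differentiableAt_const (0 : ℝ)) (differentiableAt_of_contDiffOn hU
      (contDiffOn_toSecondOrder hU hlam hhyp hij.symm ha) hqU)
  have h := fderiv_commutator_eq_zero (hI.1.contDiffAt (hW.mem_nhds hq))
    (Filter.eventually_of_mem (hW.mem_nhds hq) fun q' hq' =>
      hI.fderiv_field_u hU hlam hhyp hW hWU hki hq')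
    (Filter.eventually_of_mem (hW.mem_nhds hq) fun q' hq' =>
      hI.fderiv_field_x hU hlam hhyp hW hWU hij ha hq') hL hM
  rw [hLv, hMv, Jet.field_u, Jet.field_u, Jet.field_ux, Jet.field_ux] at h
  simp only [Jet.dirX_u, Jet.dirX_ux, Jet.dirU_u, Jet.dirU_ux, map_zero, map_sub, map_add,
    map_smul, smul_eq_mul, fderiv_single, Pi.zero_apply, fderiv_const_apply, zero_apply] at h
  norm_num at h
  linear_combination h

/-- If the distribution has an extra Riemann invariant of order `1`, then
`∂_k A_{ji} + a_{ik} A_{ji} = 0`, because the invariant depends on `u^i_x` at points with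
`u^i_x ≠ 0` projecting arbitrarily close to any given `u`. -/
theorem HasExtraRiemannInvariantOrderOne.pd_toSecondOrder (hU : IsOpen U)
    (hlam : ∀ k, ContDiffOn ℝ ∞ (lam k) U) (hhyp : StrictlyHyperbolicOn lam U)
    (h : HasExtraRiemannInvariantOrderOne lam U i) (hij : i ≠ j)
    (ha : ∀ u ∈ U, commutingCoeffs lam i j u ≠ 0) {k : Fin n} (hki : k ≠ i) {u : Fin n → ℝ}
    (hu : u ∈ U) :
    pd k (toSecondOrder i (commutingCoeffs lam) j i) u +
      commutingCoeffs lam i k u * toSecondOrder i (commutingCoeffs lam) j i u = 0 := by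
  obtain ⟨W, hW, hpW, I, hI, -, hord⟩ := h (0, 0, u, fun _ => 1) hu
  have hA := contDiffOn_toSecondOrder hU hlam hhyp hij.symm ha
  set F : (Fin n → ℝ) → ℝ := fun v => pd k (toSecondOrder i (commutingCoeffs lam) j i) v +
      commutingCoeffs lam i k v * toSecondOrder i (commutingCoeffs lam) j i v
  have hFc : ContinuousOn F U := ((contDiffOn_pd hU hA k).add
    ((contDiffOn_commutingCoeffs hU hlam hhyp hki.symm).mul hA)).continuousOn
  by_contra hne
  change F u ≠ 0 at hne
  refine hord ?_
  have hO : IsOpen (W ∩ (Jet.uL ⁻¹' U)) := hW.inter (hU.preimage Jet.uL.continuous)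
  have hI' : IsRiemannInvariantOn lam i (W ∩ (Jet.uL ⁻¹' U)) I :=
    ⟨hI.1.mono Set.inter_subset_left, fun q hq => hI.2 q hq.1⟩
  have hFq : ∀ᶠ q : Jet n in 𝓝 (0, 0, u, fun _ => 1), F (Jet.uL q) ≠ 0 :=
    (((hFc.continuousAt (hU.mem_nhds hu)).comp_of_eq Jet.uL.continuous.continuousAt rfl)
      |>.eventually_ne hne)
  have hpq : ∀ᶠ q : Jet n in 𝓝 (0, 0, u, fun _ => 1), Jet.uxL i q ≠ 0 :=
    (Jet.uxL i).continuous.continuousAt.eventually_ne (by simp [Jet.ux])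
  filter_upwards [hFq, hpq, hO.mem_nhds ⟨hpW, hu⟩] with q h1 h2 hq m
  by_cases hmi : m = i
  · subst hmi
    have := hI'.fderiv_dirUx hU hlam hhyp hO (fun q hq => hq.2) hij ha hki hq
    exact (mul_eq_zero.1 this).resolve_left (mul_ne_zero h1 (pow_ne_zero 2 h2))
  · exact hI.2 q hq.1 _ (dirUx_mem lam hmi q)

end Integrals

/-! ### Construction of the invariant -/

section Construction

variable {U : Set (Fin n → ℝ)} {lam : Fin n → (Fin n → ℝ) → ℝ} {i : Fin n}

/-- Along the distribution, a function of `u` with `∂_k g = -a_{ik} g`, `k ≠ i`, obeys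
`dg = -(D_x λ^i - u^i_x ∂_i λ^i) g dt`. -/
theorem fderiv_of_mem_mongeDistribution (hhyp : StrictlyHyperbolicOn lam U)
    {g : (Fin n → ℝ) → ℝ} {q X : Jet n} (hq : q.u ∈ U)
    (hg : ∀ k, k ≠ i → pd k g q.u + commutingCoeffs lam i k q.u * g q.u = 0)
    (hX : X ∈ mongeDistribution lam i q) :
    fderiv ℝ g q.u X.u =
      -(totalDx (lam i) q - q.ux i * pd i (lam i) q.u) * g q.u * X.t := by
  obtain ⟨-, h2, h3, -⟩ := hX
  have : q.ux i * pd i (lam i) q.u = ∑ k, if k = i then q.ux k * pd k (lam i) q.u else 0 := by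
    simp
  rw [fderiv_eq_sum_pd, this, totalDx, ← Finset.sum_sub_distrib, ← Finset.sum_neg_distrib,
    Finset.sum_mul, Finset.sum_mul]
  refine Finset.sum_congr rfl fun k _ => ?_
  by_cases hki : k = i
  · subst hki
    simp [h2]
  · rw [if_neg hki, pd_eq_commutingCoeffs_mul hhyp hq (Ne.symm hki)]
    linear_combination pd k g q.u * h3 k hki -
      (lam i q.u - lam k q.u) * q.ux k * X.t * hg k hki

/-- The numerator of the invariant `A u^i_x / (1 + u^i_x (A x + s t))`. -/
def invNum (i : Fin n) (A : (Fin n → ℝ) → ℝ) (q : Jet n) : ℝ := A q.u * q.ux i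

/-- The denominator of the invariant `A u^i_x / (1 + u^i_x (A x + s t))`. -/
def invDen (i : Fin n) (A s : (Fin n → ℝ) → ℝ) (q : Jet n) : ℝ :=
  1 + q.ux i * (A q.u * q.x + s q.u * q.t)

theorem contDiffOn_comp_u {f : (Fin n → ℝ) → ℝ} (hf : ContDiffOn ℝ ∞ f U) :
    ContDiffOn ℝ ∞ (fun q : Jet n => f q.u) (Jet.uL ⁻¹' U) :=
  hf.comp Jet.uL.contDiff.contDiffOn fun _ h => h

theorem contDiffOn_invNum {A : (Fin n → ℝ) → ℝ} (hA : ContDiffOn ℝ ∞ A U) :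
    ContDiffOn ℝ ∞ (invNum i A) (Jet.uL ⁻¹' U) :=
  (contDiffOn_comp_u hA).mul (Jet.uxL i).contDiff.contDiffOn

theorem contDiffOn_invDen {A s : (Fin n → ℝ) → ℝ} (hA : ContDiffOn ℝ ∞ A U)
    (hs : ContDiffOn ℝ ∞ s U) : ContDiffOn ℝ ∞ (invDen i A s) (Jet.uL ⁻¹' U) :=
  contDiffOn_const.add ((Jet.uxL i).contDiff.contDiffOn.mul
    (((contDiffOn_comp_u hA).mul contDiff_fst.contDiffOn).add
      ((contDiffOn_comp_u hs).mul contDiff_snd.fst.contDiffOn)))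

theorem fderiv_invNum {A : (Fin n → ℝ) → ℝ} {q : Jet n} (hA : DifferentiableAt ℝ A q.u)
    (X : Jet n) :
    fderiv ℝ (invNum i A) q X = A q.u * X.ux i + q.ux i * fderiv ℝ A q.u X.u := by
  have h := (Jet.hasFDerivAt_comp_u hA).mul (Jet.hasFDerivAt_ux i q)
  rw [show invNum i A = (fun q => A q.u) * fun q => q.ux i from rfl, h.fderiv]
  simp

theorem fderiv_invDen {A s : (Fin n → ℝ) → ℝ} {q : Jet n} (hA : DifferentiableAt ℝ A q.u)
    (hs : DifferentiableAt ℝ s q.u) (X : Jet n) :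
    fderiv ℝ (invDen i A s) q X = X.ux i * (A q.u * q.x + s q.u * q.t) +
      q.ux i * (fderiv ℝ A q.u X.u * q.x + A q.u * X.x + fderiv ℝ s q.u X.u * q.t +
        s q.u * X.t) := by
  have hx : HasFDerivAt (fun q : Jet n => q.x) (ContinuousLinearMap.fst ℝ _ _) q :=
    hasFDerivAt_fst
  have ht : HasFDerivAt (fun q : Jet n => q.t)
      ((ContinuousLinearMap.fst ℝ _ _).comp (ContinuousLinearMap.snd ℝ _ _)) q :=
    hasFDerivAt_fst.comp q hasFDerivAt_snd
  have h := ((Jet.hasFDerivAt_ux i q).mul (((Jet.hasFDerivAt_comp_u hA).mul hx).add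
    ((Jet.hasFDerivAt_comp_u hs).mul ht))).const_add 1
  have e : fderiv ℝ (invDen i A s) q = _ := h.fderiv
  rw [e]
  simp
  ring

/-- With `s = ∂_i λ^i + A λ^i`, numerator and denominator are multiplied by the same infinitesimal
factor `u^i_x ∂_i λ^i dt` along the distribution. -/
theorem fderiv_inv_of_mem (hhyp : StrictlyHyperbolicOn lam U) {A s : (Fin n → ℝ) → ℝ}
    {q X : Jet n} (hq : q.u ∈ U) (hA : DifferentiableAt ℝ A q.u) (hs : DifferentiableAt ℝ s q.u)
    (hAk : ∀ k, k ≠ i → pd k A q.u + commutingCoeffs lam i k q.u * A q.u = 0)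
    (hsk : ∀ k, k ≠ i → pd k s q.u + commutingCoeffs lam i k q.u * s q.u = 0)
    (hsA : s q.u = pd i (lam i) q.u + A q.u * lam i q.u)
    (hX : X ∈ mongeDistribution lam i q) :
    fderiv ℝ (invNum i A) q X = pd i (lam i) q.u * q.ux i * X.t * invNum i A q ∧
    fderiv ℝ (invDen i A s) q X = pd i (lam i) q.u * q.ux i * X.t * invDen i A s q := by
  have eA := fderiv_of_mem_mongeDistribution hhyp hq hAk hX
  have es := fderiv_of_mem_mongeDistribution hhyp hq hsk hX
  obtain ⟨h1, -, -, h4⟩ := hX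
  rw [fderiv_invNum hA, fderiv_invDen hA hs, eA, es, invNum, invDen]
  constructor
  · linear_combination A q.u * h4
  · linear_combination (A q.u * q.x + s q.u * q.t) * h4 + q.ux i * A q.u * h1 +
      q.ux i * X.t * hsA

/-- The quotient of two functions with proportional differentials along the distribution is an
invariant; it is an extra invariant of order `1` if it depends on `u^i_x`. -/
theorem hasExtraRiemannInvariantOrderOneAt_div {N D : Jet n → ℝ} {O : Set (Jet n)} {p : Jet n}
    (hO : IsOpen O) (hpO : p ∈ O) (hN : ContDiffOn ℝ ∞ N O) (hD : ContDiffOn ℝ ∞ D O)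
    (hDp : D p ≠ 0)
    (h : ∀ q ∈ O, ∀ X ∈ mongeDistribution lam i q, ∃ c : ℝ,
      fderiv ℝ N q X = c * N q ∧ fderiv ℝ D q X = c * D q)
    (hne : fderiv ℝ N p (Jet.dirUx i) * D p - N p * fderiv ℝ D p (Jet.dirUx i) ≠ 0) :
    HasExtraRiemannInvariantOrderOneAt lam i p := by
  have hW : IsOpen (O ∩ D ⁻¹' {0}ᶜ) :=
    hD.continuousOn.isOpen_inter_preimage hO isOpen_compl_singleton
  have hd : ∀ q ∈ O ∩ D ⁻¹' {0}ᶜ, ∀ X, fderiv ℝ (fun q => N q / D q) q X =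
      (fderiv ℝ N q X * D q - N q * fderiv ℝ D q X) / D q ^ 2 := by
    intro q hq X
    have hNq := (hN.contDiffAt (hO.mem_nhds hq.1)).differentiableAt (by simp)
    have hDq := (hD.contDiffAt (hO.mem_nhds hq.1)).differentiableAt (by simp)
    have hq0 : D q ≠ 0 := hq.2
    have h := hNq.hasFDerivAt.mul ((hasDerivAt_inv hq0).comp_hasFDerivAt q hDq.hasFDerivAt)
    rw [show (fun q => N q / D q) = N * (fun y => y⁻¹) ∘ D from funext fun q => div_eq_mul_inv _ _,
      h.fderiv]
    simp
    field_simp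
    ring
  have hI : fderiv ℝ (fun q => N q / D q) p (Jet.dirUx i) ≠ 0 := by
    rw [hd p ⟨hpO, hDp⟩]
    exact div_ne_zero hne (pow_ne_zero 2 hDp)
  refine ⟨_, hW, ⟨hpO, hDp⟩, fun q => N q / D q, ⟨?_, ?_⟩, ?_, ?_⟩
  · exact (hN.mono Set.inter_subset_left).div (hD.mono Set.inter_subset_left) fun q hq => hq.2
  · intro q hq X hX
    obtain ⟨c, h1, h2⟩ := h q hq.1 X hX
    rw [hd q hq, h1, h2]
    ring
  · have hu : fderiv ℝ (fun q : Jet n => q.u i) p =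
        (ContinuousLinearMap.proj i).comp Jet.uL :=
      ((ContinuousLinearMap.proj (R := ℝ) (φ := fun _ : Fin n => ℝ) i).comp Jet.uL).fderiv
    rw [LinearIndependent.pair_iff, hu]
    intro a b hab
    have e1 := congrArg (fun L : Jet n →L[ℝ] ℝ => L (Jet.dirUx i)) hab
    have e2 := congrArg (fun L : Jet n →L[ℝ] ℝ => L (Jet.dirU i)) hab
    have hb : b = 0 ∨ fderiv ℝ (fun q => N q / D q) p (Jet.dirUx i) = 0 := by
      simpa [Jet.u, Jet.dirUx] using e1
    have hb := hb.resolve_right hI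
    subst hb
    exact ⟨by simpa [Jet.u, Jet.dirU] using e2, rfl⟩
  · exact fun h0 => hI (h0.self_of_nhds i)

/-- The solution `s = ∂_i λ^i + A λ^i` of `∂_k s = -a_{ik} s`. -/
theorem pd_add_mul_eq (hU : IsOpen U) (hlam : ∀ k, ContDiffOn ℝ ∞ (lam k) U)
    (hhyp : StrictlyHyperbolicOn lam U) {A : (Fin n → ℝ) → ℝ} {u : Fin n → ℝ} (hu : u ∈ U)
    (hA : DifferentiableAt ℝ A u) {k : Fin n} (hki : k ≠ i)
    (ha : commutingCoeffs lam i k u ≠ 0)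
    (hAk : pd k A u + commutingCoeffs lam i k u * A u = 0)
    (hAe : toSecondOrder i (commutingCoeffs lam) k i u = A u) :
    pd k (fun v => pd i (lam i) v + A v * lam i v) u +
      commutingCoeffs lam i k u * (pd i (lam i) u + A u * lam i u) = 0 := by
  have hl := differentiableAt_of_contDiffOn hU (hlam i) hu
  have h := pd_mul_toSecondOrder hU hlam hhyp hki hu ha
  rw [hAe] at h
  rw [pd_add (differentiableAt_of_contDiffOn hU (contDiffOn_pd hU (hlam i) i) hu) (hA.fun_mul hl),
    pd_mul hA hl]
  linear_combination h + lam i u * hAk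

/-- The invariant `A u^i_x / (1 + u^i_x (A x + s t))` or, where the denominator vanishes, its
inverse. -/
theorem hasExtraRiemannInvariantOrderOne_of_pd (hU : IsOpen U)
    (hlam : ∀ k, ContDiffOn ℝ ∞ (lam k) U) (hhyp : StrictlyHyperbolicOn lam U)
    {A : (Fin n → ℝ) → ℝ} (hA : ContDiffOn ℝ ∞ A U) (hA0 : ∀ u ∈ U, A u ≠ 0)
    (ha : ∀ u ∈ U, ∀ k, k ≠ i → commutingCoeffs lam i k u ≠ 0)
    (hAk : ∀ u ∈ U, ∀ k, k ≠ i → pd k A u + commutingCoeffs lam i k u * A u = 0)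
    (hAe : ∀ u ∈ U, ∀ k, k ≠ i → toSecondOrder i (commutingCoeffs lam) k i u = A u) :
    HasExtraRiemannInvariantOrderOne lam U i := by
  intro p hp
  set s : (Fin n → ℝ) → ℝ := fun v => pd i (lam i) v + A v * lam i v
  have hsc : ContDiffOn ℝ ∞ s U := (contDiffOn_pd hU (hlam i) i).add (hA.mul (hlam i))
  have hO : IsOpen ((Jet.uL : Jet n →L[ℝ] _) ⁻¹' U) := hU.preimage Jet.uL.continuous
  have hdA := fun u hu => differentiableAt_of_contDiffOn (u := u) hU hA hu
  have hds := fun u hu => differentiableAt_of_contDiffOn (u := u) hU hsc hu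
  have key : ∀ q ∈ (Jet.uL : Jet n →L[ℝ] _) ⁻¹' U, ∀ X ∈ mongeDistribution lam i q, ∃ c : ℝ,
      fderiv ℝ (invNum i A) q X = c * invNum i A q ∧
      fderiv ℝ (invDen i A s) q X = c * invDen i A s q := fun q hq X hX =>
    ⟨_, fderiv_inv_of_mem hhyp hq (hdA _ hq) (hds _ hq) (hAk _ hq)
      (fun k hki => pd_add_mul_eq hU hlam hhyp hq (hdA _ hq) hki (ha _ hq k hki) (hAk _ hq k hki)
        (hAe _ hq k hki)) rfl hX⟩
  have eN : fderiv ℝ (invNum i A) p (Jet.dirUx i) = A p.u := by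
    rw [fderiv_invNum (hdA _ hp)]
    simp [Jet.dirUx, Jet.u, Jet.ux]
  have eD : fderiv ℝ (invDen i A s) p (Jet.dirUx i) = A p.u * p.x + s p.u * p.t := by
    rw [fderiv_invDen (hdA _ hp) (hds _ hp)]
    simp [Jet.dirUx, Jet.u, Jet.ux, Jet.x, Jet.t]
  -- the derivative of the quotient in `u^i_x` has the numerator `A (1 + p w) - A p w = A`
  have hwr : fderiv ℝ (invNum i A) p (Jet.dirUx i) * invDen i A s p -
      invNum i A p * fderiv ℝ (invDen i A s) p (Jet.dirUx i) = A p.u := by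
    rw [eN, eD, invNum, invDen]
    ring
  by_cases hD : invDen i A s p = 0
  · have hN : invNum i A p ≠ 0 := by
      intro h0
      rw [hD, h0] at hwr
      exact hA0 _ hp (by simpa using hwr.symm)
    refine hasExtraRiemannInvariantOrderOneAt_div hO hp (contDiffOn_invDen hA hsc)
      (contDiffOn_invNum hA) hN (fun q hq X hX => (key q hq X hX).imp fun _ h => h.symm) ?_
    intro h0
    exact hA0 _ hp (by linear_combination -hwr - h0)
  · refine hasExtraRiemannInvariantOrderOneAt_div hO hp (contDiffOn_invNum hA)
      (contDiffOn_invDen hA hsc) hD key ?_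
    rw [hwr]
    exact hA0 _ hp

end Construction

end

end Hydro

theorem theorem3 {n : ℕ} (U : Set (Fin n → ℝ)) (hU : IsOpen U)
    (lam : Fin n → (Fin n → ℝ) → ℝ) (hsmooth : ∀ k, ContDiffOn ℝ ∞ (lam k) U)
    (hhyp : Hydro.StrictlyHyperbolicOn lam U) (hsemi : Hydro.SemihamiltonianOn lam U)
    (i j : Fin n) (hij : i ≠ j)
    -- the coefficients `a_{im}` do not vanish
    (ha : ∀ u ∈ U, ∀ m, m ≠ i → Hydro.commutingCoeffs lam i m u ≠ 0)
    -- the coefficients `a_{mj}` are pairwise distinct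
    (hdist : ∀ u ∈ U, ∀ m m', m ≠ j → m' ≠ j → m ≠ m' →
      Hydro.commutingCoeffs lam m j u ≠ Hydro.commutingCoeffs lam m' j u)
    -- the Laplace transformation for the pair `i, j` is defined: its remaining denominator
    -- `a_{ji} - ∂_i a_{ij} / a_{ij}` does not vanish
    (hdef : ∀ u ∈ U, Hydro.commutingCoeffs lam j i u -
      Hydro.pd i (Hydro.commutingCoeffs lam i j) u / Hydro.commutingCoeffs lam i j u ≠ 0) :
    Hydro.HasExtraRiemannInvariantOrderOne lam U i ↔
      ∀ u ∈ U, ∀ m, m ≠ i →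
        Hydro.laplace i j (Hydro.commutingCoeffs lam) i m u = 0 := by
  have hA0 : ∀ u ∈ U,
      Hydro.toSecondOrder i (Hydro.commutingCoeffs lam) j i u ≠ 0 := by
    rw [Hydro.toSecondOrder_of_ne hij.symm]
    exact hdef
  have haj := fun u hu => ha u hu j hij.symm
  -- `ā_{im} = 0` is the equation `∂_m A_{ji} = -a_{im} A_{ji}`
  have hiff : ∀ u ∈ U, ∀ m, Hydro.laplace i j (Hydro.commutingCoeffs lam) i m u = 0 ↔
      Hydro.pd m (Hydro.toSecondOrder i (Hydro.commutingCoeffs lam) j i) u +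
        Hydro.commutingCoeffs lam i m u *
          Hydro.toSecondOrder i (Hydro.commutingCoeffs lam) j i u = 0 := by
    intro u hu m
    rw [Hydro.laplace_apply_left hij, ← mul_left_inj' (hA0 u hu), add_mul,
      div_mul_cancel₀ _ (hA0 u hu), zero_mul, add_comm]
  constructor
  · intro h u hu m hm
    exact (hiff u hu m).2 (h.pd_toSecondOrder hU hsmooth hhyp hij haj hm hu)
  · intro h
    have hAk := fun u hu m hm => (hiff u hu m).1 (h u hu m hm)
    refine Hydro.hasExtraRiemannInvariantOrderOne_of_pd hU hsmooth hhyp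
      (Hydro.contDiffOn_toSecondOrder hU hsmooth hhyp hij.symm haj) hA0 ha hAk fun u hu k hki => ?_
    by_cases hkj : k = j
    · rw [hkj]
    · have e := Hydro.pd_toSecondOrder_add hU hsmooth hhyp hsemi hij hki hkj ha hu
      rw [hAk u hu k hki, zero_mul] at e
      have e' := ((mul_eq_zero.1 e.symm).resolve_right
        (sub_ne_zero.2 (hdist u hu i k hij hkj (Ne.symm hki))))
      exact (sub_eq_zero.1 ((mul_eq_zero.1 e').resolve_left (ha u hu k hki))).symm
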